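/- Consider a Markov decision process with finite nonempty state space $\mathcal S$, finite action space $\mathcal A$, transition matrices $P_a$ ($a\in\mathcal A$), reward function $\mathcal R:\mathcal S\times\mathcal A\to[0,1]$ and discount factor $\gamma\in(0,1)$. Let $\pi$ be a policy such that the Markov chain $\mathcal M_{\mathcal S}$ on $\mathcal S$ with transition matrix $P_\pi(s,s')=\sum_a\pi(a|s)P_a(s,s')$ is irreducible and aperiodic; let $\kappa$ be its stationary distribution, $\mathcal K_{\min}=\min_s\kappa(s)$, and for $\delta>0$ let $$t_\delta=\min\{k\ge 0:\ \max_{s}\|P_\pi^k(s,\cdot)-\kappa\|_{\mathrm{TV}}\le\delta\},\qquad \|p-q\|_{\mathrm{TV}}=\tfrac12\sum_s|p(s)-q(s)|.$$ Let $V_\pi(s)=\mathbb E_\pi\big[\sum_{k\ge0}\gamma^k\mathcal R(S_k,A_k)\,\big|\,S_0=s\big]$. Let $\{(S_k,A_k)\}_{k\ge0}$ be a trajectory of the process with all actions selected according to $\pi$ and an arbitrary distribution of $S_0$. Let $n\ge1$ be an integer, $\alpha>0$, and $V_0\in\mathbb R^{|\mathcal S|}$ deterministic. Asynchronous on-policy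 $n$-step TD with constant stepsize $\alpha$ is the recursion $$V_{k+1}(S_k)=V_k(S_k)+\alpha\Big(\sum_{i=0}^{n-1}\gamma^i\mathcal R(S_{k+i},A_{k+i})+\gamma^nV_k(S_{k+n})-V_k(S_k)\Big),\qquad V_{k+1}(s)=V_k(s)\ \text{ for } s\ne S_k .$$ Put $\beta_3=1-\mathcal K_{\min}(1-\gamma^n)$. There is a numerical constant $\hat c_0>0$ (independent of the process, of $\pi$, and of $n,\alpha,V_0$ and the initial distribution) such that whenever $\alpha(t_\alpha+n)\le\hat c_0(1-\beta_3)$, for all $k\ge t_\alpha+n$, $$\mathbb E\big[\|V_k-V_\pi\|_2^2\big]\le \hat c_1\big(1-(1-\beta_3)\alpha\big)^{k-(t_\alpha+n)}+\hat c_2\,\frac{\alpha(t_\alpha+n)}{(1-\gamma)^2(1-\beta_3)},$$ where $\hat c_1=(\|V_0-V_\pi\|_2+\|V_0\|_2+4)^2$ and $\hat c_2=228\,(4(1-\gamma)\|V_\pi\|_2+1)^2$. -/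

import Mathlib

open MeasureTheory ProbabilityTheory Finset
open scoped Matrix

noncomputable section

namespace NStepTD

/-- A Markov decision process with state space `S`, action space `A`, transition probabilities
`P a s s'`, deterministic rewards in `[0, 1]` and discount factor in `(0, 1)`. -/
structure MDP (S A : Type*) where
  /-- `P a s` is the row at `s` of the transition matrix of the action `a`. -/
  P : A → S → PMF S
  /-- The reward function. -/
  R : S → A → ℝ
  R_mem : ∀ s a, R s a ∈ Set.Icc (0 : ℝ) 1
  /-- The discount factor. -/
  γ : ℝ
  γ_mem : γ ∈ Set.Ioo (0 : ℝ) 1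

/-- A (stationary, randomized) policy: `π s a` is the probability `π(a | s)`. -/
abbrev Policy (S A : Type*) := S → PMF A

variable {S A : Type*}

/-- The joint law of `(s, a)` when `s ∼ ν` and `a ∼ π(· | s)`. -/
def stateAction (π : Policy S A) (ν : PMF S) : PMF (S × A) :=
  ν.bind fun s => (π s).map (Prod.mk s)

/-- The transition matrix `P_π(s, s') = ∑ a, π(a | s) P_a(s, s')` of the state chain `{S_k}`
under the policy `π`. -/
def transMatrix [Fintype A] (M : MDP S A) (π : Policy S A) : Matrix S S ℝ :=
  Matrix.of fun s s' => ∑ a, (π s a).toReal * (M.P a s s').toReal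

/-- Every state has period one: the gcd of its possible return times is `1`. -/
def IsAperiodic [Fintype S] [DecidableEq S] (P : Matrix S S ℝ) : Prop :=
  ∀ s, Nat.setGcd {k : ℕ | 1 ≤ k ∧ 0 < (P ^ k) s s} = 1

/-- `κ` is a stationary distribution of the chain with transition matrix `P`. -/
def IsStationary [Fintype S] (P : Matrix S S ℝ) (κ : S → ℝ) : Prop :=
  κ ∈ stdSimplex ℝ S ∧ κ ᵥ* P = κ

/-- Total variation distance between two probability vectors on a finite set. -/
def tvDist [Fintype S] (p q : S → ℝ) : ℝ :=
  (1 / 2) * ∑ s, |p s - q s|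

/-- Mixing time with precision `δ`:
`min {k ≥ 0 : max_s ‖P^k(s, ·) - κ‖_TV ≤ δ}`. -/
def mixingTime [Fintype S] [DecidableEq S] (P : Matrix S S ℝ) (κ : S → ℝ) (δ : ℝ) : ℕ :=
  sInf {k : ℕ | ∀ s, tvDist ((P ^ k) s) κ ≤ δ}

/-- The minimal entry of the stationary distribution. -/
def kMin (κ : S → ℝ) : ℝ := ⨅ s, κ s

/-- The contraction factor `β₃ = 1 - K_min (1 - γ ^ n)`. -/
def beta3 (M : MDP S A) (κ : S → ℝ) (n : ℕ) : ℝ := 1 - kMin κ * (1 - M.γ ^ n)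

section Trajectories

variable [MeasurableSpace S] [DiscreteMeasurableSpace S] [Fintype S]
  [MeasurableSpace A] [DiscreteMeasurableSpace A] [Fintype A]

/-- One step of the state-action chain: from `(s, a)` draw `s' ∼ P_a(s, ·)`, then
`a' ∼ π(· | s')`. -/
def stepKernel (M : MDP S A) (π : Policy S A) : Kernel (S × A) (S × A) where
  toFun x := (stateAction π (M.P x.2 x.1)).toMeasure
  measurable' := measurable_of_finite _

instance (M : MDP S A) (π : Policy S A) : IsMarkovKernel (stepKernel M π) :=
  ⟨fun x => inferInstanceAs
    (IsProbabilityMeasure (stateAction π (M.P x.2 x.1)).toMeasure)⟩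

/-- The law on `(S × A)^ℕ` of the trajectory `(S_k, A_k)_{k ≥ 0}` with `S_0 ∼ ν` and all actions
selected according to `π`. -/
def trajLaw (M : MDP S A) (π : Policy S A) (ν : PMF S) : Measure (ℕ → S × A) :=
  Kernel.trajMeasure (X := fun _ => S × A) (stateAction π ν).toMeasure
    fun k => (stepKernel M π).comap
      (fun x : (i : Finset.Iic k) → S × A => x ⟨k, Finset.mem_Iic.2 le_rfl⟩)
      (measurable_pi_apply _)

/-- The value function `V_π(s) = 𝔼_π[∑ₖ γ ^ k R(S_k, A_k) | S_0 = s]`, as a vector of the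
Euclidean space `ℝ^S`. -/
def valueFn (M : MDP S A) (π : Policy S A) : EuclideanSpace ℝ S :=
  WithLp.toLp 2 fun s =>
    ∫ ω, ∑' k : ℕ, M.γ ^ k * M.R (ω k).1 (ω k).2 ∂(trajLaw M π (PMF.pure s))

end Trajectories

/-- The `n`-step temporal difference `Γ₃(V, s_0, a_0, …, s_n)` along the first `n` steps of the
state-action sequence `ω`. -/
def tdError (M : MDP S A) (n : ℕ) (V : EuclideanSpace ℝ S) (ω : ℕ → S × A) : ℝ :=
  ∑ i ∈ range n, M.γ ^ i * M.R (ω i).1 (ω i).2 + M.γ ^ n * V (ω n).1 - V (ω 0).1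

/-- The iterates of asynchronous `n`-step TD with stepsizes `α` and initialization `V₀` along the
trajectory `ω = (S_k, A_k)_{k ≥ 0}`: the `k`-th update changes only the entry of the state `S_k`. -/
def tdIterate [DecidableEq S] (M : MDP S A) (n : ℕ) (α : ℕ → ℝ) (V₀ : EuclideanSpace ℝ S)
    (ω : ℕ → S × A) : ℕ → EuclideanSpace ℝ S
  | 0 => V₀
  | k + 1 => WithLp.toLp 2 fun s =>
      if s = (ω k).1 then
        tdIterate M n α V₀ ω k s
          + α k * tdError M n (tdIterate M n α V₀ ω k) (fun i => ω (k + i))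
      else tdIterate M n α V₀ ω k s

end NStepTD

end

namespace NStepTD

/-! The squared Euclidean error is a Lyapunov function. With x = V_k - V_π and Γ the temporal
difference, one update adds 2α x(S_k) Γ + α² Γ². Here Γ is the temporal difference of V_π, centred
given S_k by the Bellman equation (`integral_mul_tdError_valueFn`), plus the linear part γ^n
x(S_{k+n}) - x(S_k). If S_k had law κ independently of x, convexity and stationarity would bound the
mean of x(S_k) Γ by -c‖x‖², where c = 1 - β₃ (`IsStationary.sum_mul_drift_le`).

Since S_k and V_k are correlated, the cross term is evaluated at the iterate lagged by T = t + n.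
That iterate is determined by the pairs before time k - t, and t further steps bring the conditional
law of S_k within α of κ in total variation, at a cost of 4α‖x‖² (`integral_crossTerm_le`).
Returning to the current iterate costs O(αT), because the iterates move slowly
(`norm_sub_le_of_step`). When αT ≤ c/1000, these errors consume at most half of the drift 2αc, which
leaves E_{k+1} ≤ (1 - αc) E_k + 98 α² T B² with B = 1/(1 - γ). This recursion is summed
geometrically from time T. -/

lemma abs_sum_mul_sub_le_tvDist {S : Type*} [Fintype S] (p q f : S → ℝ)
    {C : ℝ} (hf : ∀ s, |f s| ≤ C) :
    |∑ s, p s * f s - ∑ s, q s * f s| ≤ 2 * tvDist p q * C := by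
  rw [← sum_sub_distrib, tvDist, ← mul_assoc, mul_one_div_cancel two_ne_zero, one_mul, sum_mul]
  refine (abs_sum_le_sum_abs _ _).trans (sum_le_sum fun s _ => ?_)
  rw [← sub_mul, abs_mul]
  exact mul_le_mul_of_nonneg_left (hf s) (abs_nonneg _)

/-! ### Finite Markov chains: convergence to stationarity and dissipativity -/

section MarkovChain

variable {S : Type*} [Fintype S] [DecidableEq S] {P : Matrix S S ℝ} {κ : S → ℝ}

lemma pow_apply_mul_le_pow_add (hP : ∀ i j, 0 ≤ P i j) (a b : ℕ) (i j l : S) :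
    (P ^ a) i j * (P ^ b) j l ≤ (P ^ (a + b)) i l := by
  rw [pow_add, Matrix.mul_apply]
  exact single_le_sum (f := fun j => (P ^ a) i j * (P ^ b) j l)
    (fun x _ => mul_nonneg (Matrix.pow_apply_nonneg hP a i x) (Matrix.pow_apply_nonneg hP b x l))
    (mem_univ j)

/-- The return times form an additive semigroup of gcd one, and such a semigroup contains every
large integer. -/
lemma eventually_pow_apply_self_pos (hP : ∀ i j, 0 ≤ P i j) (hap : IsAperiodic P) (i : S) :
    ∀ᶠ m in Filter.atTop, 0 < (P ^ m) i i := by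
  obtain ⟨N, hN⟩ := Nat.exists_mem_closure_of_ge {k : ℕ | 1 ≤ k ∧ 0 < (P ^ k) i i}
  rw [hap i] at hN
  filter_upwards [Filter.eventually_ge_atTop N] with m hm
  refine AddSubmonoid.closure_induction (motive := fun k _ => 0 < (P ^ k) i i)
    (fun k hk => hk.2) (by simp) (fun a b _ _ ha hb => ?_) (hN m hm (one_dvd _))
  exact (mul_pos ha hb).trans_le (pow_apply_mul_le_pow_add hP a b i i i)

/-- An irreducible aperiodic matrix is primitive. -/
lemma exists_pow_pos_of_isIrreducible (hirr : P.IsIrreducible) (hap : IsAperiodic P) :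
    ∃ N, ∀ i j, 0 < (P ^ N) i j := by
  have hP := hirr.nonneg
  have h : ∀ i j, ∀ᶠ m in Filter.atTop, 0 < (P ^ m) i j := by
    intro i j
    obtain ⟨k, -, hk⟩ := (Matrix.isIrreducible_iff_exists_pow_pos hP).1 hirr i j
    have := (Filter.tendsto_sub_atTop_nat k).eventually (eventually_pow_apply_self_pos hP hap i)
    filter_upwards [this, Filter.eventually_ge_atTop k] with m hm hkm
    have h2 := pow_apply_mul_le_pow_add hP (m - k) k i i j
    rw [Nat.sub_add_cancel hkm] at h2
    exact (mul_pos hm hk).trans_le h2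
  simp_rw [← Filter.eventually_all] at h
  exact h.exists

/-- A positive row stochastic matrix contracts the `ℓ¹` norm of vectors with zero sum. -/
lemma sum_abs_vecMul_le {Q : Matrix S S ℝ} (hQ : Q ∈ Matrix.rowStochastic ℝ S) {ε : ℝ}
    (hε : ∀ i j, ε ≤ Q i j) {d : S → ℝ} (hd : ∑ s, d s = 0) :
    ∑ s, |(d ᵥ* Q) s| ≤ (1 - Fintype.card S * ε) * ∑ s, |d s| := by
  -- Doeblin's trick: subtracting the constant ε from Q changes nothing because d has zero sum,
  -- while the remaining matrix is still nonnegative and has row sums 1 - |S| ε.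
  have h1 : ∀ s, (d ᵥ* Q) s = ∑ i, d i * (Q i s - ε) := by
    intro s
    simp only [Matrix.vecMul, dotProduct, mul_sub, sum_sub_distrib, ← sum_mul, hd, zero_mul,
      sub_zero]
  calc ∑ s, |(d ᵥ* Q) s| ≤ ∑ s, ∑ i, |d i| * (Q i s - ε) := by
        refine sum_le_sum fun s _ => ?_
        rw [h1]
        refine (abs_sum_le_sum_abs _ _).trans (sum_le_sum fun i _ => ?_)
        rw [abs_mul, abs_of_nonneg (sub_nonneg.2 (hε i s))]
    _ = (1 - Fintype.card S * ε) * ∑ s, |d s| := by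
        rw [sum_comm, mul_sum]
        refine sum_congr rfl fun i _ => ?_
        rw [← mul_sum, sum_sub_distrib, Matrix.sum_row_of_mem_rowStochastic hQ, sum_const,
          card_univ, nsmul_eq_mul, mul_comm]

lemma IsStationary.vecMul_pow (h : IsStationary P κ) (k : ℕ) : κ ᵥ* P ^ k = κ := by
  induction k with
  | zero => simp
  | succ k ih => rw [pow_succ, ← Matrix.vecMul_vecMul, ih, h.2]

/-- The convergence theorem for irreducible aperiodic chains on a finite state space. -/
lemma exists_forall_tvDist_le (hP : P ∈ Matrix.rowStochastic ℝ S) (hirr : P.IsIrreducible)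
    (hap : IsAperiodic P) (hκ : IsStationary P κ) {δ : ℝ} (hδ : 0 < δ) :
    ∃ k, ∀ s, tvDist ((P ^ k) s) κ ≤ δ := by
  cases isEmpty_or_nonempty S
  · exact ⟨0, fun s => isEmptyElim s⟩
  obtain ⟨N, hN⟩ := exists_pow_pos_of_isIrreducible hirr hap
  have hQ : P ^ N ∈ Matrix.rowStochastic ℝ S := pow_mem hP N
  obtain ⟨⟨a, b⟩, hab⟩ := Finite.exists_min fun x : S × S => (P ^ N) x.1 x.2
  set ε := (P ^ N) a b with hεdef
  have hε : ∀ i j, ε ≤ (P ^ N) i j := fun i j => hab (i, j)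
  have hε0 : 0 < ε := hN a b
  set r := 1 - Fintype.card S * ε with hr
  have hr1 : r < 1 := by
    have : (0 : ℝ) < Fintype.card S := by exact_mod_cast Fintype.card_pos
    have := mul_pos this hε0
    linarith
  have hr0 : 0 ≤ r := by
    have h : ∑ _j : S, ε ≤ ∑ j, (P ^ N) a j := sum_le_sum fun j _ => hε a j
    rw [Matrix.sum_row_of_mem_rowStochastic hQ, sum_const, card_univ, nsmul_eq_mul] at h
    linarith
  have key : ∀ (s : S) (m : ℕ), ∑ x, |((P ^ N) ^ m) s x - κ x| ≤
      r ^ m * ∑ x, |(1 : Matrix S S ℝ) s x - κ x| := by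
    intro s m
    induction m with
    | zero => simp
    | succ m ih =>
      have e : (fun x => ((P ^ N) ^ (m + 1)) s x - κ x) =
          (fun x => ((P ^ N) ^ m) s x - κ x) ᵥ* P ^ N := by
        have : (fun x => ((P ^ N) ^ m) s x - κ x) = ((P ^ N) ^ m) s - κ := rfl
        rw [this, Matrix.sub_vecMul, hκ.vecMul_pow, pow_succ]
        rfl
      have hd : ∑ x, (((P ^ N) ^ m) s x - κ x) = 0 := by
        rw [sum_sub_distrib, Matrix.sum_row_of_mem_rowStochastic (pow_mem hQ m), hκ.1.2, sub_self]
      have h2 := sum_abs_vecMul_le hQ hε hd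
      rw [← e] at h2
      calc _ ≤ r * ∑ x, |((P ^ N) ^ m) s x - κ x| := h2
        _ ≤ r * (r ^ m * ∑ x, |(1 : Matrix S S ℝ) s x - κ x|) := by gcongr
        _ = _ := by ring
  have hlim : ∀ s : S, ∀ᶠ m in Filter.atTop, tvDist ((P ^ (N * m)) s) κ ≤ δ := by
    intro s
    have ht : Filter.Tendsto (fun m : ℕ => (1 / 2) *
        (r ^ m * ∑ x, |(1 : Matrix S S ℝ) s x - κ x|)) Filter.atTop (nhds 0) := by
      simpa using ((tendsto_pow_atTop_nhds_zero_of_lt_one hr0 hr1).mul_const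
        (∑ x, |(1 : Matrix S S ℝ) s x - κ x|)).const_mul (1 / 2 : ℝ)
    filter_upwards [ht.eventually_le_const hδ] with m hm
    refine le_trans ?_ hm
    rw [tvDist, pow_mul]
    exact mul_le_mul_of_nonneg_left (key s m) (by norm_num)
  rw [← Filter.eventually_all] at hlim
  obtain ⟨m, hm⟩ := hlim.exists
  exact ⟨N * m, hm⟩

/-- In `ℕ` the infimum of the empty set is 0, so the mixing time has its meaning only once the
convergence theorem shows that the set is nonempty. -/
lemma tvDist_pow_mixingTime_le (hP : P ∈ Matrix.rowStochastic ℝ S) (hirr : P.IsIrreducible)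
    (hap : IsAperiodic P) (hκ : IsStationary P κ) {δ : ℝ} (hδ : 0 < δ) (s : S) :
    tvDist ((P ^ mixingTime P κ δ) s) κ ≤ δ :=
  Nat.sInf_mem (s := {k : ℕ | ∀ s, tvDist ((P ^ k) s) κ ≤ δ})
    (exists_forall_tvDist_le hP hirr hap hκ hδ) s

/-- The averaged `n`-step operator is dissipative with respect to the stationary distribution. -/
lemma IsStationary.sum_mul_drift_le (hP : P ∈ Matrix.rowStochastic ℝ S) (hκ : IsStationary P κ)
    (n : ℕ) {g : ℝ} (hg0 : 0 ≤ g) (hg1 : g ≤ 1) (x : S → ℝ) :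
    ∑ s, κ s * (x s * (g * ((P ^ n) *ᵥ x) s - x s)) ≤ -(kMin κ * (1 - g)) * ∑ s, x s ^ 2 := by
  have hQ : P ^ n ∈ Matrix.rowStochastic ℝ S := pow_mem hP n
  -- 2ab ≤ a² + b², averaged over the row of `P ^ n`; stationarity then turns the average of the
  -- squares back into the κ-weighted sum.
  have hjen : ∀ s, x s * ((P ^ n) *ᵥ x) s ≤ (x s ^ 2 + ((P ^ n) *ᵥ fun i => x i ^ 2) s) / 2 := by
    intro s
    have h1 : x s ^ 2 = ∑ i, (P ^ n) s i * x s ^ 2 := by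
      rw [← sum_mul, Matrix.sum_row_of_mem_rowStochastic hQ, one_mul]
    rw [h1]
    simp only [Matrix.mulVec, dotProduct]
    rw [mul_sum, ← sum_add_distrib, sum_div]
    refine sum_le_sum fun i _ => ?_
    have h2 : 0 ≤ (P ^ n) s i := Matrix.nonneg_of_mem_rowStochastic hQ
    nlinarith [mul_nonneg h2 (sq_nonneg (x s - x i))]
  have hinv : ∑ s, κ s * ((P ^ n) *ᵥ fun i => x i ^ 2) s = ∑ s, κ s * x s ^ 2 := by
    have := Matrix.dotProduct_mulVec κ (P ^ n) (fun i => x i ^ 2)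
    rw [hκ.vecMul_pow] at this
    exact this
  have hmin : ∀ s, kMin κ ≤ κ s := fun s => ciInf_le (Set.finite_range κ).bddBelow s
  calc ∑ s, κ s * (x s * (g * ((P ^ n) *ᵥ x) s - x s))
      ≤ ∑ s, (g / 2 * (κ s * x s ^ 2) + g / 2 * (κ s * ((P ^ n) *ᵥ fun i => x i ^ 2) s)
          - κ s * x s ^ 2) := by
        refine sum_le_sum fun s _ => ?_
        have h3 := mul_le_mul_of_nonneg_left (hjen s) (mul_nonneg hg0 (hκ.1.1 s))
        linarith
    _ = -(∑ s, (1 - g) * (κ s * x s ^ 2)) := by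
        rw [sum_sub_distrib, sum_add_distrib, ← mul_sum, ← mul_sum, hinv, ← mul_sum]
        ring
    _ ≤ -(∑ s, (1 - g) * (kMin κ * x s ^ 2)) := by
        refine neg_le_neg (sum_le_sum fun s _ => ?_)
        have := hmin s
        have h4 : 0 ≤ 1 - g := by linarith
        gcongr
    _ = _ := by
        rw [← mul_sum, ← mul_sum]
        ring

end MarkovChain

/-! ### Functions of finitely many coordinates of a trajectory -/

section Paths

variable {S A : Type*}

/-- The function depends on the trajectory only through the pairs before time `j` and the state
at time `j`. -/
def DependsOnUpToState {E : Type*} (j : ℕ) (G : (ℕ → S × A) → E) : Prop :=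
  ∀ ⦃ω ω' : ℕ → S × A⦄, (∀ i < j, ω i = ω' i) → (ω j).1 = (ω' j).1 → G ω = G ω'

lemma DependsOnUpToState.dependsOn {E : Type*} {j : ℕ} {G : (ℕ → S × A) → E}
    (hG : DependsOnUpToState j G) : DependsOn G (Set.Iic j) :=
  fun _ _ h => hG (fun i hi => h i hi.le) (congrArg Prod.fst (h j Set.self_mem_Iic))

lemma DependsOnUpToState.mono {E : Type*} {i j : ℕ} (hij : i ≤ j) {G : (ℕ → S × A) → E}
    (hG : DependsOnUpToState i G) : DependsOnUpToState j G := by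
  intro ω ω' h h'
  refine hG (fun l hl => h l (hl.trans_le hij)) ?_
  rcases hij.lt_or_eq with hlt | rfl
  · rw [h i hlt]
  · exact h'

/-- Continue a finite path by repeating its last entry. -/
def extendPath (N : ℕ) (p : (i : Finset.Iic N) → S × A) : ℕ → S × A :=
  fun i => p ⟨min i N, Finset.mem_Iic.2 (min_le_right i N)⟩

lemma extendPath_frestrictLe {N i : ℕ} (h : i ≤ N) (ω : ℕ → S × A) :
    extendPath N (Preorder.frestrictLe (π := fun _ => S × A) N ω) i = ω i := by
  simp [extendPath, h]

/-- Factoring through a finite type makes boundedness, measurability and integrability automatic. -/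
lemma eq_extendPath_of_dependsOn {E : Type*} {N : ℕ} {G : (ℕ → S × A) → E}
    (hG : DependsOn G (Set.Iic N)) (ω : ℕ → S × A) :
    G ω = G (extendPath N (Preorder.frestrictLe (π := fun _ => S × A) N ω)) :=
  hG fun _ hi => (extendPath_frestrictLe hi ω).symm

lemma exists_norm_le_of_dependsOn [Fintype S] [Fintype A] {E : Type*} [NormedAddCommGroup E]
    {N : ℕ} {G : (ℕ → S × A) → E} (hG : DependsOn G (Set.Iic N)) : ∃ C, ∀ ω, ‖G ω‖ ≤ C := by
  cases nonempty_fintype ((i : Finset.Iic N) → S × A)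
  obtain ⟨C, hC⟩ := (Set.finite_range fun p => ‖G (extendPath N p)‖).bddAbove
  exact ⟨C, fun ω => by
    rw [eq_extendPath_of_dependsOn hG ω]
    exact hC ⟨_, rfl⟩⟩

lemma sum_toReal_eq_one {α : Type*} [Fintype α] (p : PMF α) : ∑ a, (p a).toReal = 1 := by
  rw [← ENNReal.toReal_sum fun a _ => p.apply_ne_top a, ← tsum_fintype (L := .unconditional α),
    p.tsum_coe, ENNReal.toReal_one]

lemma transMatrix_mulVec_apply [Fintype S] [Fintype A] {M : MDP S A} {π : Policy S A}
    (h : S → ℝ) (s : S) :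
    (transMatrix M π *ᵥ h) s =
      ∑ a, (π s a).toReal * ∑ s', (M.P a s s').toReal * h s' := by
  simp only [transMatrix, Matrix.mulVec, dotProduct, Matrix.of_apply, sum_mul, mul_sum]
  rw [sum_comm]
  simp only [mul_assoc]

lemma transMatrix_mem_rowStochastic [Fintype S] [Fintype A] [DecidableEq S] (M : MDP S A)
    (π : Policy S A) :
    transMatrix M π ∈ Matrix.rowStochastic ℝ S := by
  rw [Matrix.mem_rowStochastic_iff_sum]
  refine ⟨fun i j => sum_nonneg fun a _ => by positivity, fun i => ?_⟩
  have := transMatrix_mulVec_apply (M := M) (π := π) (fun _ => (1 : ℝ)) i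
  simpa [Matrix.mulVec, dotProduct, sum_toReal_eq_one] using this

end Paths

/-! ### The trajectory law and its Markov property -/

section Trajectories

variable {S A : Type*} [MeasurableSpace S] [DiscreteMeasurableSpace S] [Fintype S]
  [MeasurableSpace A] [DiscreteMeasurableSpace A] [Fintype A]

instance (M : MDP S A) (π : Policy S A) (ν : PMF S) : IsProbabilityMeasure (trajLaw M π ν) := by
  unfold trajLaw
  infer_instance

lemma integral_stateAction (π : Policy S A) (ν : PMF S) (f : S × A → ℝ) :
    ∫ x, f x ∂(stateAction π ν).toMeasure =
      ∑ s, (ν s).toReal * ∑ a, (π s a).toReal * f (s, a) := by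
  classical
  have h : ∀ s a, ((stateAction π ν) (s, a)).toReal = (ν s).toReal * (π s a).toReal := by
    intro s a
    rw [stateAction, PMF.bind_apply, tsum_eq_single s, PMF.map_apply, tsum_eq_single a]
    · simp
    · intro b hb
      simp [hb.symm]
    · intro b hb
      rw [PMF.map_apply]
      simp [hb.symm]
  rw [PMF.integral_eq_sum, Fintype.sum_prod_type]
  simp only [h, smul_eq_mul, mul_sum, mul_assoc]

lemma measurable_of_dependsOn {E : Type*} [MeasurableSpace E] {N : ℕ} {G : (ℕ → S × A) → E}
    (hG : DependsOn G (Set.Iic N)) : Measurable G := by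
  have h : G = (fun p => G (extendPath N p)) ∘ Preorder.frestrictLe (π := fun _ => S × A) N :=
    funext fun ω => eq_extendPath_of_dependsOn hG ω
  rw [h]
  exact (measurable_of_finite _).comp (Preorder.measurable_frestrictLe N)

lemma integrable_of_dependsOn {μ : Measure (ℕ → S × A)} [IsFiniteMeasure μ] {N : ℕ}
    {G : (ℕ → S × A) → ℝ} (hG : DependsOn G (Set.Iic N)) : Integrable G μ := by
  obtain ⟨C, hC⟩ := exists_norm_le_of_dependsOn hG
  exact Integrable.of_bound (measurable_of_dependsOn hG).aestronglyMeasurable C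
    (Filter.Eventually.of_forall hC)

variable {M : MDP S A} {π : Policy S A} {ν : PMF S}

/-- Conditioning on the first `N + 1` pairs of a trajectory. -/
lemma integral_trajLaw_succ {N : ℕ} {G : (ℕ → S × A) → ℝ} (hG : DependsOn G (Set.Iic (N + 1))) :
    ∫ ω, G ω ∂(trajLaw M π ν) = ∫ ω, ∑ s, (M.P (ω N).2 (ω N).1 s).toReal *
      ∑ a, (π s a).toReal * G (Function.update ω (N + 1) (s, a)) ∂(trajLaw M π ν) := by
  set F : ((i : Finset.Iic N) → S × A) × (S × A) → ℝ :=
    fun q => G (Function.update (extendPath N q.1) (N + 1) q.2) with hF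
  have hFm : Measurable F := measurable_of_finite _
  have hle : Measurable (fun x : ℕ → S × A => Preorder.frestrictLe (π := fun _ => S × A) N x) :=
    Preorder.measurable_frestrictLe N
  have h1 : ∀ ω, G ω = F (Preorder.frestrictLe (π := fun _ => S × A) N ω, ω (N + 1)) := by
    intro ω
    refine hG fun i hi => ?_
    rcases Nat.lt_or_eq_of_le (Set.mem_Iic.1 hi) with h | rfl
    · rw [Function.update_of_ne h.ne, extendPath_frestrictLe (Nat.lt_succ_iff.1 h)]
    · rw [Function.update_self]
  have h2 : ∀ ω y, G (Function.update ω (N + 1) y) =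
      F (Preorder.frestrictLe (π := fun _ => S × A) N ω, y) := by
    intro ω y
    refine hG fun i hi => ?_
    rcases Nat.lt_or_eq_of_le (Set.mem_Iic.1 hi) with h | rfl
    · rw [Function.update_of_ne h.ne, Function.update_of_ne h.ne,
        extendPath_frestrictLe (Nat.lt_succ_iff.1 h)]
    · rw [Function.update_self, Function.update_self]
  have hpair : Measurable (fun x : ℕ → S × A =>
      (Preorder.frestrictLe (π := fun _ => S × A) N x, x (N + 1))) :=
    hle.prodMk (measurable_pi_apply _)
  simp_rw [h2, h1]
  rw [← integral_map (μ := trajLaw M π ν) hpair.aemeasurable hFm.aestronglyMeasurable]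
  have hmap := Kernel.map_frestrictLe_trajMeasure_compProd_eq_map_trajMeasure
    (X := fun _ => S × A) (μ₀ := (stateAction π ν).toMeasure)
    (κ := fun k => (stepKernel M π).comap
      (fun x : (i : Finset.Iic k) → S × A => x ⟨k, Finset.mem_Iic.2 le_rfl⟩)
      (measurable_pi_apply _)) (a := N)
  rw [trajLaw, ← hmap, Measure.integral_compProd, integral_map hle.aemeasurable]
  · refine integral_congr_ae (Filter.Eventually.of_forall fun ω => ?_)
    simp only [Kernel.comap_apply]
    exact integral_stateAction π _ _
  · exact (measurable_of_finite _).aestronglyMeasurable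
  · exact Integrable.of_finite

/-- The initial pair of a trajectory. -/
lemma integral_trajLaw_zero {G : (ℕ → S × A) → ℝ} (hG : DependsOn G (Set.Iic 0)) :
    ∫ ω, G ω ∂(trajLaw M π ν) = ∫ ω, ∑ s, (ν s).toReal *
      ∑ a, (π s a).toReal * G (Function.update ω 0 (s, a)) ∂(trajLaw M π ν) := by
  set F : ((i : Finset.Iic 0) → S × A) → ℝ := fun p => G (extendPath 0 p) with hF
  have hFm : Measurable F := measurable_of_finite _
  have hle : Measurable (fun x : ℕ → S × A => Preorder.frestrictLe (π := fun _ => S × A) 0 x) :=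
    Preorder.measurable_frestrictLe 0
  set e := (MeasurableEquiv.piUnique (fun _ : Finset.Iic 0 => S × A)).symm
  have h1 : ∀ ω, G ω = F (Preorder.frestrictLe (π := fun _ => S × A) 0 ω) :=
    eq_extendPath_of_dependsOn hG
  have h2 : ∀ ω y, G (Function.update ω 0 y) = F (e y) := by
    intro ω y
    refine hG fun i hi => ?_
    obtain rfl : i = 0 := Nat.le_zero.1 hi
    rw [Function.update_self]
    rfl
  have hmap : (trajLaw M π ν).map (Preorder.frestrictLe (π := fun _ => S × A) 0) =
      (stateAction π ν).toMeasure.map e := by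
    rw [trajLaw, Kernel.trajMeasure, Measure.map_comp _ _ hle, Kernel.traj_map_frestrictLe,
      Kernel.partialTraj_self, Measure.id_comp]
  simp_rw [h2, h1]
  rw [← integral_map (μ := trajLaw M π ν) hle.aemeasurable hFm.aestronglyMeasurable, hmap,
    integral_map e.measurable.aemeasurable hFm.aestronglyMeasurable, integral_stateAction]
  simp

/-- Treats time 0 and later times together: for averaging over an action only the factor π matters,
so the weights of the state stay unspecified. -/
lemma exists_integral_trajLaw_eq (M : MDP S A) (π : Policy S A) (ν : PMF S) (j : ℕ) :
    ∃ w : (ℕ → S × A) → S → ℝ, ∀ G : (ℕ → S × A) → ℝ, DependsOn G (Set.Iic j) →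
      ∫ ω, G ω ∂(trajLaw M π ν) = ∫ ω, ∑ s, w ω s *
        ∑ a, (π s a).toReal * G (Function.update ω j (s, a)) ∂(trajLaw M π ν) := by
  cases j with
  | zero => exact ⟨_, fun G hG => integral_trajLaw_zero hG⟩
  | succ N => exact ⟨_, fun G hG => integral_trajLaw_succ hG⟩

/-- Averaging over the action taken at time `j`. -/
lemma integral_mul_pair {j : ℕ} {G : (ℕ → S × A) → ℝ} (hG : DependsOnUpToState j G)
    (f : S × A → ℝ) :
    ∫ ω, G ω * f (ω j) ∂(trajLaw M π ν) =
      ∫ ω, G ω * ∑ a, (π (ω j).1 a).toReal * f ((ω j).1, a) ∂(trajLaw M π ν) := by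
  obtain ⟨w, hw⟩ := exists_integral_trajLaw_eq M π ν j
  rw [hw (fun ω => G ω * f (ω j)),
    hw (fun ω => G ω * ∑ a, (π (ω j).1 a).toReal * f ((ω j).1, a))]
  · refine integral_congr_ae (Filter.Eventually.of_forall fun ω => ?_)
    refine sum_congr rfl fun s _ => ?_
    congr 1
    -- G does not see the action at time j, so any fixed action serves as a reference value.
    obtain ⟨a₀, -⟩ := (π s).support_nonempty
    have hc : ∀ a, G (Function.update ω j (s, a)) = G (Function.update ω j (s, a₀)) := by
      intro a
      refine hG (fun i hi => ?_) ?_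
      · rw [Function.update_of_ne hi.ne, Function.update_of_ne hi.ne]
      · rw [Function.update_self, Function.update_self]
    simp only [Function.update_self, hc]
    rw [← sum_mul, sum_toReal_eq_one, one_mul, mul_sum]
    exact sum_congr rfl fun a _ => by ring
  · intro ω ω' h
    simp only [hG.dependsOn h, h j Set.self_mem_Iic]
  · intro ω ω' h
    simp only [hG.dependsOn h, h j Set.self_mem_Iic]

/-- Averaging over the next state, given the current pair. -/
lemma integral_mul_succ {j : ℕ} {G : (ℕ → S × A) → ℝ} (hG : DependsOn G (Set.Iic j))
    (h : S → ℝ) :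
    ∫ ω, G ω * h (ω (j + 1)).1 ∂(trajLaw M π ν) =
      ∫ ω, G ω * ∑ s, (M.P (ω j).2 (ω j).1 s).toReal * h s ∂(trajLaw M π ν) := by
  rw [integral_trajLaw_succ (N := j) (G := fun ω => G ω * h (ω (j + 1)).1)]
  · refine integral_congr_ae (Filter.Eventually.of_forall fun ω => ?_)
    simp only [Function.update_self]
    rw [mul_sum]
    refine sum_congr rfl fun s _ => ?_
    have hc : ∀ y, G (Function.update ω (j + 1) y) = G ω := fun y =>
      hG fun i hi => Function.update_of_ne (Nat.lt_succ_of_le hi).ne _ _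
    simp only [hc]
    rw [← sum_mul, sum_toReal_eq_one]
    ring
  · intro ω ω' hω
    have : G ω = G ω' := hG fun i hi => hω i (Nat.le_succ_of_le hi)
    simp only [this, hω (j + 1) Set.self_mem_Iic]

/-- The Markov property of the state chain. -/
lemma integral_mul_state_succ {j : ℕ} {G : (ℕ → S × A) → ℝ} (hG : DependsOnUpToState j G)
    (h : S → ℝ) :
    ∫ ω, G ω * h (ω (j + 1)).1 ∂(trajLaw M π ν) =
      ∫ ω, G ω * (transMatrix M π *ᵥ h) (ω j).1 ∂(trajLaw M π ν) := by
  rw [integral_mul_succ hG.dependsOn,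
    integral_mul_pair hG fun y => ∑ s, (M.P y.2 y.1 s).toReal * h s]
  simp only [transMatrix_mulVec_apply]

lemma integral_mul_state_add [DecidableEq S] {j : ℕ} {G : (ℕ → S × A) → ℝ}
    (hG : DependsOnUpToState j G) (i : ℕ) (h : S → ℝ) :
    ∫ ω, G ω * h (ω (j + i)).1 ∂(trajLaw M π ν) =
      ∫ ω, G ω * ((transMatrix M π ^ i) *ᵥ h) (ω j).1 ∂(trajLaw M π ν) := by
  induction i generalizing h with
  | zero => simp
  | succ i ih =>
    rw [← add_assoc, integral_mul_state_succ (hG.mono (Nat.le_add_right j i)), ih,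
      Matrix.mulVec_mulVec, ← pow_succ]

/-- The Markov property of the state chain for random test functions. -/
lemma integral_state_add [DecidableEq S] {j : ℕ} {H : (ℕ → S × A) → S → ℝ}
    (hH : DependsOnUpToState j H) (i : ℕ) :
    ∫ ω, H ω (ω (j + i)).1 ∂(trajLaw M π ν) =
      ∫ ω, ((transMatrix M π ^ i) *ᵥ H ω) (ω j).1 ∂(trajLaw M π ν) := by
  have hHs : ∀ s, DependsOnUpToState j fun ω => H ω s := fun s ω ω' h h' =>
    congrFun (hH h h') s
  -- Expansion in indicators of states reduces a random test function to deterministic ones with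
  -- adapted coefficients.
  have e1 : ∀ ω, H ω (ω (j + i)).1 =
      ∑ s, H ω s * (Pi.single s 1 : S → ℝ) (ω (j + i)).1 := by
    intro ω
    rw [sum_eq_single (ω (j + i)).1] <;> simp +contextual [eq_comm]
  have e2 : ∀ ω, ((transMatrix M π ^ i) *ᵥ H ω) (ω j).1 =
      ∑ s, H ω s * ((transMatrix M π ^ i) *ᵥ (Pi.single s 1 : S → ℝ)) (ω j).1 := by
    intro ω
    simp [Matrix.mulVec, dotProduct, mul_comm, Pi.single_apply]
  simp_rw [e1, e2]
  rw [integral_finsetSum, integral_finsetSum]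
  · exact sum_congr rfl fun s _ => integral_mul_state_add (hHs s) i _
  · intro s _
    refine integrable_of_dependsOn (N := j) fun ω ω' h => ?_
    simp only [(hHs s).dependsOn h, h j Set.self_mem_Iic]
  · intro s _
    refine integrable_of_dependsOn (N := j + i) fun ω ω' h => ?_
    have : H ω s = H ω' s := (hHs s).dependsOn fun l hl => h l (Nat.le_add_right_of_le hl)
    simp only [this, h (j + i) Set.self_mem_Iic]

end Trajectories

/-! ### The value function, the Bellman equation and centred temporal differences -/

section ValueFunction

variable {S A : Type*} [MeasurableSpace S] [DiscreteMeasurableSpace S] [Fintype S]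
  [MeasurableSpace A] [DiscreteMeasurableSpace A] [Fintype A]

/-- The expected reward at a state under a policy. -/
noncomputable def meanReward {S A : Type*} [Fintype A] (M : MDP S A) (π : Policy S A) (s : S) :
    ℝ :=
  ∑ a, (π s a).toReal * M.R s a

lemma integral_state_zero (M : MDP S A) (π : Policy S A) (s : S) (h : S → ℝ) :
    ∫ ω, h (ω 0).1 ∂(trajLaw M π (PMF.pure s)) = h s := by
  rw [integral_trajLaw_zero (G := fun ω => h (ω 0).1)]
  · simp only [Function.update_self, ← sum_mul, sum_toReal_eq_one, one_mul]
    rw [sum_eq_single s] <;> simp +contextual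
  · intro ω ω' hω
    simp only [hω 0 Set.self_mem_Iic]

variable [DecidableEq S]

lemma integral_reward (M : MDP S A) (π : Policy S A) (s : S) (k : ℕ) :
    ∫ ω, M.R (ω k).1 (ω k).2 ∂(trajLaw M π (PMF.pure s)) =
      ((transMatrix M π ^ k) *ᵥ meanReward M π) s := by
  have h1 := integral_mul_pair (M := M) (π := π) (ν := PMF.pure s) (j := k) (G := fun _ => 1)
    (fun _ _ _ _ => rfl) fun y => M.R y.1 y.2
  have h2 := integral_mul_state_add (M := M) (π := π) (ν := PMF.pure s) (j := 0)
    (G := fun _ => 1) (fun _ _ _ _ => rfl) k (meanReward M π)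
  simp only [one_mul, zero_add] at h1 h2
  rw [h1, ← integral_state_zero M π s ((transMatrix M π ^ k) *ᵥ meanReward M π)]
  exact h2

/-- Sum and integral are exchanged by geometric domination of the discounted rewards. -/
lemma valueFn_hasSum (M : MDP S A) (π : Policy S A) (s : S) :
    HasSum (fun k => M.γ ^ k * ((transMatrix M π ^ k) *ᵥ meanReward M π) s)
      (valueFn M π s) := by
  have hγ := M.γ_mem
  have hm : ∀ k, Measurable fun ω : ℕ → S × A => M.γ ^ k * M.R (ω k).1 (ω k).2 := fun k =>
    measurable_of_dependsOn (N := k) fun ω ω' h => by simp only [h k Set.self_mem_Iic]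
  have hb : ∀ k (ω : ℕ → S × A), ‖M.γ ^ k * M.R (ω k).1 (ω k).2‖ ≤ M.γ ^ k := by
    intro k ω
    have hR := M.R_mem (ω k).1 (ω k).2
    rw [Real.norm_of_nonneg (mul_nonneg (pow_nonneg hγ.1.le k) hR.1)]
    exact mul_le_of_le_one_right (pow_nonneg hγ.1.le k) hR.2
  have hi : ∀ k, Integrable (fun ω : ℕ → S × A => M.γ ^ k * M.R (ω k).1 (ω k).2)
      (trajLaw M π (PMF.pure s)) := fun k =>
    Integrable.of_bound (hm k).aestronglyMeasurable _ (Filter.Eventually.of_forall (hb k))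
  have hs : Summable fun k => ∫ ω, ‖M.γ ^ k * M.R (ω k).1 (ω k).2‖
      ∂(trajLaw M π (PMF.pure s)) := by
    refine Summable.of_nonneg_of_le (fun k => integral_nonneg fun ω => norm_nonneg _) (fun k => ?_)
      (summable_geometric_of_lt_one hγ.1.le hγ.2)
    calc _ ≤ ∫ _ω, M.γ ^ k ∂(trajLaw M π (PMF.pure s)) :=
          integral_mono (hi k).norm (integrable_const _) (hb k)
      _ = M.γ ^ k := by simp
  have h := hasSum_integral_of_summable_integral_norm hi hs
  simp only [integral_const_mul, integral_reward] at h
  exact h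

lemma valueFn_mem_Icc (M : MDP S A) (π : Policy S A) (s : S) :
    valueFn M π s ∈ Set.Icc 0 (1 - M.γ)⁻¹ := by
  have hγ := M.γ_mem
  have hr : ∀ k, ((transMatrix M π ^ k) *ᵥ meanReward M π) s ∈ Set.Icc (0 : ℝ) 1 := by
    intro k
    rw [← integral_reward]
    constructor
    · exact integral_nonneg fun ω => (M.R_mem _ _).1
    · calc _ ≤ ∫ _ω, (1 : ℝ) ∂(trajLaw M π (PMF.pure s)) :=
            integral_mono_of_nonneg (Filter.Eventually.of_forall fun ω => (M.R_mem _ _).1)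
              (integrable_const _) (Filter.Eventually.of_forall fun ω => (M.R_mem _ _).2)
        _ = 1 := by simp
  constructor
  · exact (valueFn_hasSum M π s).nonneg fun k => mul_nonneg (pow_nonneg hγ.1.le k) (hr k).1
  · exact hasSum_le (fun k => mul_le_of_le_one_right (pow_nonneg hγ.1.le k) (hr k).2)
      (valueFn_hasSum M π s) (hasSum_geometric_of_lt_one hγ.1.le hγ.2)

/-- The Bellman equation of a policy. -/
lemma valueFn_eq (M : MDP S A) (π : Policy S A) (s : S) :
    valueFn M π s = meanReward M π s + M.γ * (transMatrix M π *ᵥ valueFn M π) s := by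
  have h1 : HasSum (fun k => M.γ ^ (k + 1) *
      ((transMatrix M π ^ (k + 1)) *ᵥ meanReward M π) s)
      (M.γ * (transMatrix M π *ᵥ valueFn M π) s) := by
    have h := (hasSum_sum (s := univ) fun s' _ =>
      (valueFn_hasSum M π s').mul_left (transMatrix M π s s')).mul_left M.γ
    convert! h using 2 with k
    rw [pow_succ' (transMatrix M π), ← Matrix.mulVec_mulVec]
    conv_lhs => rw [Matrix.mulVec, dotProduct]
    rw [mul_sum, mul_sum]
    exact sum_congr rfl fun s' _ => by ring
  have h2 := (valueFn_hasSum M π s).unique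
    (h1.zero_add (f := fun k => M.γ ^ k * ((transMatrix M π ^ k) *ᵥ meanReward M π) s))
  simpa using h2

/-- Telescoping into one-step differences, each of which the Bellman equation centres. -/
lemma tdError_succ {S A : Type*} (M : MDP S A) (n : ℕ) (V : EuclideanSpace ℝ S)
    (ω : ℕ → S × A) : tdError M (n + 1) V ω = tdError M n V ω +
      M.γ ^ n * (M.R (ω n).1 (ω n).2 + M.γ * V (ω (n + 1)).1 - V (ω n).1) := by
  simp only [tdError, sum_range_succ, pow_succ]
  ring

lemma tdError_dependsOn {S A : Type*} (M : MDP S A) (n k : ℕ) (V : EuclideanSpace ℝ S) :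
    DependsOn (fun ω : ℕ → S × A => tdError M n V fun i => ω (k + i)) (Set.Iic (k + n)) := by
  intro ω ω' h
  simp only [tdError]
  rw [h (k + n) Set.self_mem_Iic, h (k + 0) (Nat.add_le_add_left (Nat.zero_le n) k)]
  congr 2
  refine sum_congr rfl fun i hi => ?_
  rw [h (k + i) (Nat.add_le_add_left (mem_range.1 hi).le k)]

/-- The temporal differences of the value function are centred. -/
lemma integral_mul_tdError_valueFn {M : MDP S A} {π : Policy S A} {ν : PMF S} {k : ℕ}
    {G : (ℕ → S × A) → ℝ} (hG : DependsOnUpToState k G) (n : ℕ) :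
    ∫ ω, G ω * tdError M n (valueFn M π) (fun i => ω (k + i)) ∂(trajLaw M π ν) = 0 := by
  induction n with
  | zero => simp [tdError]
  | succ n ih =>
    have hGn : DependsOnUpToState (k + n) G := hG.mono (Nat.le_add_right k n)
    have hG1 : DependsOn G (Set.Iic (k + n)) := hGn.dependsOn
    have hG2 : DependsOn G (Set.Iic (k + n + 1)) := (hGn.mono (Nat.le_succ _)).dependsOn
    set v := valueFn M π with hv
    have i1 : Integrable (fun ω => G ω * tdError M n v fun i => ω (k + i)) (trajLaw M π ν) :=
      integrable_of_dependsOn (N := k + n) fun ω ω' h => by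
        have h2 := tdError_dependsOn M n k v h
        simp only at h2
        rw [hG1 h, h2]
    have i2 : Integrable (fun ω => G ω * M.R (ω (k + n)).1 (ω (k + n)).2) (trajLaw M π ν) :=
      integrable_of_dependsOn (N := k + n) fun ω ω' h => by
        simp only [hG1 h, h (k + n) Set.self_mem_Iic]
    have i3 : Integrable (fun ω => G ω * v (ω (k + n + 1)).1) (trajLaw M π ν) :=
      integrable_of_dependsOn (N := k + n + 1) fun ω ω' h => by
        simp only [hG2 h, h (k + n + 1) Set.self_mem_Iic]
    have i4 : Integrable (fun ω => G ω * v (ω (k + n)).1) (trajLaw M π ν) :=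
      integrable_of_dependsOn (N := k + n) fun ω ω' h => by
        simp only [hG1 h, h (k + n) Set.self_mem_Iic]
    have i5 : Integrable (fun ω => G ω * (transMatrix M π *ᵥ v) (ω (k + n)).1)
        (trajLaw M π ν) :=
      integrable_of_dependsOn (N := k + n) fun ω ω' h => by
        simp only [hG1 h, h (k + n) Set.self_mem_Iic]
    have i6 : Integrable (fun ω => G ω * meanReward M π (ω (k + n)).1) (trajLaw M π ν) :=
      integrable_of_dependsOn (N := k + n) fun ω ω' h => by
        simp only [hG1 h, h (k + n) Set.self_mem_Iic]
    have e1 := integral_mul_pair (M := M) (π := π) (ν := ν) hGn fun y => M.R y.1 y.2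
    have e2 := integral_mul_state_succ (M := M) (π := π) (ν := ν) hGn v
    have e3 : ∫ ω, G ω * v (ω (k + n)).1 ∂(trajLaw M π ν) =
        ∫ ω, G ω * meanReward M π (ω (k + n)).1 ∂(trajLaw M π ν) +
        M.γ * ∫ ω, G ω * (transMatrix M π *ᵥ v) (ω (k + n)).1 ∂(trajLaw M π ν) := by
      rw [← integral_const_mul, ← integral_add i6 (i5.const_mul _)]
      refine integral_congr_ae (Filter.Eventually.of_forall fun ω => ?_)
      simp only
      rw [hv, valueFn_eq]
      ring
    have e4 : ∀ ω : ℕ → S × A, G ω * tdError M (n + 1) v (fun i => ω (k + i)) =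
        G ω * tdError M n v (fun i => ω (k + i)) +
        M.γ ^ n * (G ω * M.R (ω (k + n)).1 (ω (k + n)).2 +
          M.γ * (G ω * v (ω (k + n + 1)).1) - G ω * v (ω (k + n)).1) := by
      intro ω
      rw [tdError_succ, add_assoc]
      ring
    simp_rw [e4]
    have i7 := i2.fun_add (i3.const_mul M.γ)
    have i8 : Integrable (fun ω => G ω * M.R (ω (k + n)).1 (ω (k + n)).2 +
        M.γ * (G ω * v (ω (k + n + 1)).1) - G ω * v (ω (k + n)).1) (trajLaw M π ν) := i7.sub i4
    rw [integral_add i1 (i8.const_mul _), ih, integral_const_mul, integral_sub i7 i4,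
      integral_add i2 (i3.const_mul _), integral_const_mul, e1, e2, e3]
    simp only [meanReward]
    ring

/-- The n-step return bootstrapped with V_π and the value V_π(S_0) both lie in [0, 1/(1 - γ)], so
the bound does not depend on n. -/
lemma abs_tdError_valueFn_le (M : MDP S A) (π : Policy S A) (n : ℕ) (ω : ℕ → S × A) :
    |tdError M n (valueFn M π) ω| ≤ (1 - M.γ)⁻¹ := by
  have hγ := M.γ_mem
  have hγ1 : 0 < 1 - M.γ := sub_pos.2 hγ.2
  have hn := valueFn_mem_Icc M π (ω n).1
  have h0 := valueFn_mem_Icc M π (ω 0).1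
  have hs0 : 0 ≤ ∑ i ∈ range n, M.γ ^ i * M.R (ω i).1 (ω i).2 :=
    sum_nonneg fun i _ => mul_nonneg (pow_nonneg hγ.1.le i) (M.R_mem _ _).1
  have hs1 : ∑ i ∈ range n, M.γ ^ i * M.R (ω i).1 (ω i).2 ≤ (1 - M.γ ^ n) * (1 - M.γ)⁻¹ := by
    calc _ ≤ ∑ i ∈ range n, M.γ ^ i := sum_le_sum fun i _ =>
          mul_le_of_le_one_right (pow_nonneg hγ.1.le i) (M.R_mem _ _).2
      _ = _ := by
          rw [geom_sum_eq hγ.2.ne, ← neg_div_neg_eq, neg_sub, neg_sub, div_eq_mul_inv]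
  have hg := pow_nonneg hγ.1.le n
  have h2 := mul_le_mul_of_nonneg_left hn.2 hg
  have h3 := mul_nonneg hg hn.1
  have h4 := h0.1
  have h5 := h0.2
  rw [tdError, abs_le]
  constructor <;> linarith

end ValueFunction

/-! ### Scalar recursions and the numerical constants -/

section Recursion

lemma norm_sub_le_of_step {E : Type*} [NormedAddCommGroup E] {x : ℕ → E} {α B : ℝ}
    (hα : 0 ≤ α) (hB : 0 ≤ B) (h : ∀ k, ‖x (k + 1) - x k‖ ≤ α * (B + 2 * ‖x k‖)) (m j : ℕ)
    (hj : 4 * (α * j) ≤ 1) : ‖x (m + j) - x m‖ ≤ 4 * (α * j) * (‖x m‖ + B / 2) := by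
  induction j with
  | zero => simp
  | succ j ih =>
    push_cast at hj ⊢
    have hj' : 4 * (α * j) ≤ 1 := by linarith
    have ih := ih hj'
    have h1 := h (m + j)
    rw [add_assoc] at h1
    have h2 : ‖x (m + (j + 1)) - x m‖ ≤ ‖x (m + (j + 1)) - x (m + j)‖ + ‖x (m + j) - x m‖ :=
      norm_sub_le_norm_sub_add_norm_sub _ _ _
    have h3 : ‖x (m + j)‖ ≤ ‖x m‖ + ‖x (m + j) - x m‖ := norm_le_norm_add_norm_sub' _ _
    -- Up to this time the norm is at most 2‖x m‖ + B/2, so each step has length at most 4α(‖x m‖ +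
    -- B/2).
    have h4 : 4 * (α * j) * (‖x m‖ + B / 2) ≤ 1 * (‖x m‖ + B / 2) :=
      mul_le_mul_of_nonneg_right hj' (by positivity)
    have h5 : α * (B + 2 * ‖x (m + j)‖) ≤ α * (4 * (‖x m‖ + B / 2)) :=
      mul_le_mul_of_nonneg_left (by linarith) hα
    linarith

lemma le_geometric_of_le_mul_add {E : ℕ → ℝ} {ρ b : ℝ} (hρ0 : 0 ≤ ρ) (hρ1 : ρ < 1) (hb : 0 ≤ b)
    {T : ℕ} (h : ∀ k, T ≤ k → E (k + 1) ≤ ρ * E k + b) {k : ℕ} (hk : T ≤ k) :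
    E k ≤ ρ ^ (k - T) * E T + b / (1 - ρ) := by
  have h1 : 0 < 1 - ρ := by linarith
  induction k, hk using Nat.le_induction with
  | base =>
    have := div_nonneg hb h1.le
    simp only [Nat.sub_self, pow_zero, one_mul]
    linarith
  | succ k hk ih =>
    rw [Nat.succ_sub hk, pow_succ]
    have h2 := mul_le_mul_of_nonneg_left ih hρ0
    have h3 : ρ * (b / (1 - ρ)) + b = b / (1 - ρ) := by
      field_simp
      ring
    have h4 := h k hk
    linarith

/-- The scalar estimate behind the one-step drift inequality. -/
lemma drift_scalar_bound {X Y Δ B α τ c : ℝ} (hX : 0 ≤ X) (hY : 0 ≤ Y) (hB : 0 ≤ B) (hα : 0 ≤ α)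
    (hτ : 1 ≤ τ) (hc1 : c ≤ 1) (hατ : 1000 * (α * τ) ≤ c) (hΔ0 : 0 ≤ Δ)
    (hΔ : Δ ≤ 4 * (α * τ) * (Y + B / 2)) (hXY : X ≤ Y + Δ) (hYX : Y ≤ X + Δ) :
    X ^ 2 + 2 * α * ((4 * α - c) * Y ^ 2 + (Δ * B + 2 * Δ * (X + Y))) + α ^ 2 * (B + 2 * X) ^ 2
      ≤ (1 - α * c) * X ^ 2 + 98 * α * (α * τ) * B ^ 2 := by
  set a := α * τ with ha
  have hαa : α ≤ a := le_mul_of_one_le_right hα hτ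
  have ha0 : 0 ≤ a := hα.trans hαa
  have hc0 : 0 ≤ c := by linarith
  set u := X + B / 2 with hu
  have hu0 : 0 ≤ u := by positivity
  -- Y is replaced by X + Δ, and the extra 4aΔ ≤ Δ/2 is absorbed on the left.
  have hΔu : Δ ≤ 8 * a * u := by
    have h1 : 4 * a * (Y + B / 2) ≤ 4 * a * (u + Δ) :=
      mul_le_mul_of_nonneg_left (by linarith) (by linarith)
    have h2 : 4 * a * Δ ≤ 1 / 2 * Δ := mul_le_mul_of_nonneg_right (by linarith) hΔ0
    linarith
  have hΔ1 : Δ ≤ u := hΔu.trans (mul_le_of_le_one_left hu0 (by linarith))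
  have hXu : X ≤ u := by linarith
  have hYu : Y ≤ 2 * u := by linarith
  have hBu : B ≤ 2 * u := by linarith
  have hY2 : X ^ 2 - 2 * Δ * X ≤ Y ^ 2 := by
    rcases le_total Δ X with h | h
    · have : (X - Δ) ^ 2 ≤ Y ^ 2 := pow_le_pow_left₀ (by linarith) (by linarith) 2
      linarith [sq_nonneg Δ]
    · have := mul_le_mul_of_nonneg_right h hX
      have h5 := mul_nonneg hΔ0 hX
      linarith [sq_nonneg Y]
  have t1 : c * (X ^ 2 - 2 * Δ * X) ≤ c * Y ^ 2 := mul_le_mul_of_nonneg_left hY2 hc0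
  have t2 : Δ * X ≤ 8 * a * u * u := mul_le_mul hΔu hXu hX (by positivity)
  have t3 : c * (Δ * X) ≤ 1 * (Δ * X) := mul_le_mul_of_nonneg_right hc1 (by positivity)
  have t4 : α * Y ^ 2 ≤ a * (2 * u) ^ 2 :=
    mul_le_mul hαa (pow_le_pow_left₀ hY hYu 2) (by positivity) ha0
  have t5 : Δ * B ≤ 8 * a * u * (2 * u) := mul_le_mul hΔu hBu hB (by positivity)
  have t6 : Δ * (X + Y) ≤ 8 * a * u * (3 * u) :=
    mul_le_mul hΔu (by linarith) (by positivity) (by positivity)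
  have t7 : α * (B + 2 * X) ^ 2 ≤ a * (2 * u) ^ 2 :=
    mul_le_mul hαa (by rw [hu]; apply le_of_eq; ring) (by positivity) ha0
  have t8 : a * u ^ 2 ≤ a * (2 * X ^ 2 + B ^ 2 / 2) :=
    mul_le_mul_of_nonneg_left (by rw [hu]; linarith [sq_nonneg (X - B / 2)]) ha0
  have t9 : 392 * a * X ^ 2 ≤ c * X ^ 2 := mul_le_mul_of_nonneg_right (by linarith) (sq_nonneg X)
  -- The errors are 32 (mixing), 32 (Y² against X²), 32 + 96 (lag) and 4 (second order) times a u².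
  -- The total 196 a u² is at most 392 a X² + 98 a B², and half of the drift 2cX² absorbs the first
  -- term.
  have key : 2 * ((4 * α - c) * Y ^ 2 + (Δ * B + 2 * Δ * (X + Y))) + α * (B + 2 * X) ^ 2
      ≤ -c * X ^ 2 + 98 * a * B ^ 2 := by linarith
  have := mul_le_mul_of_nonneg_left key hα
  linarith

lemma initial_scalar_bound {X v p Δ B a : ℝ} (hX : 0 ≤ X) (hv : 0 ≤ v) (hp : 0 ≤ p) (hB : 0 ≤ B)
    (ha : 0 ≤ a) (ha1 : 1000 * a ≤ 1) (hXvp : X ≤ v + p) (hΔ0 : 0 ≤ Δ)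
    (hΔ : Δ ≤ 4 * a * (X + B / 2)) :
    (X + Δ) ^ 2 ≤ (X + v + 4) ^ 2 + 128 * (a * (4 * p + B) ^ 2) := by
  set L := 4 * p + B with hL
  have hL0 : 0 ≤ L := by positivity
  have h1 : Δ ≤ 4 * a * (v + L) := hΔ.trans (mul_le_mul_of_nonneg_left (by linarith) (by linarith))
  have h2 : X ≤ v + L := by linarith
  have h3 : Δ ≤ v + L := h1.trans (mul_le_of_le_one_left (by linarith) (by linarith))
  have h4 : Δ * Δ ≤ 4 * a * (v + L) * (v + L) := mul_le_mul h1 h3 hΔ0 (by positivity)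
  have h5 : X * Δ ≤ (v + L) * (4 * a * (v + L)) := mul_le_mul h2 h1 hΔ0 (by linarith)
  have h6 : a * (v + L) ^ 2 ≤ a * (2 * v ^ 2 + 2 * L ^ 2) :=
    mul_le_mul_of_nonneg_left (by linarith [sq_nonneg (v - L)]) ha
  have h7 : 1000 * a * v ^ 2 ≤ 1 * v ^ 2 := mul_le_mul_of_nonneg_right ha1 (sq_nonneg v)
  have h8 := mul_nonneg hX hv
  have h9 : 0 ≤ a * L ^ 2 := by positivity
  have h10 : 0 ≤ a * v ^ 2 := by positivity
  have e1 : (X + Δ) ^ 2 = X ^ 2 + 2 * (X * Δ) + Δ * Δ := by ring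
  have e2 : (X + v + 4) ^ 2 = X ^ 2 + v ^ 2 + 16 + 2 * (X * v) + 8 * X + 8 * v := by ring
  rw [e1, e2]
  linarith

end Recursion

/-! ### Pathwise estimates for the iterates -/

section Pathwise

variable {S A : Type*} [DecidableEq S]

lemma tdIterate_succ (M : MDP S A) (n : ℕ) (α : ℕ → ℝ) (V₀ : EuclideanSpace ℝ S)
    (ω : ℕ → S × A) (k : ℕ) :
    tdIterate M n α V₀ ω (k + 1) = tdIterate M n α V₀ ω k + EuclideanSpace.single (ω k).1
      (α k * tdError M n (tdIterate M n α V₀ ω k) fun i => ω (k + i)) := by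
  ext s
  by_cases h : s = (ω k).1 <;> simp [tdIterate, h]

/-- Update k - 1 looks ahead to time k - 1 + n, hence the strict bound; this lookahead is why n
enters the lag. -/
lemma tdIterate_congr (M : MDP S A) (n : ℕ) (α : ℕ → ℝ) (V₀ : EuclideanSpace ℝ S) (k : ℕ)
    {ω ω' : ℕ → S × A} (h : ∀ i < k + n, ω i = ω' i) :
    tdIterate M n α V₀ ω k = tdIterate M n α V₀ ω' k := by
  induction k with
  | zero => rfl
  | succ k ih =>
    have h1 := tdError_dependsOn M n k (tdIterate M n α V₀ ω' k)
      (x := ω) (y := ω') fun i hi => h i (by rw [Set.mem_Iic] at hi; lia)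
    simp only at h1
    rw [tdIterate_succ, tdIterate_succ, ih fun i hi => h i (by lia), h k (by lia), h1]

variable [Fintype S]

lemma abs_apply_le_norm {S : Type*} [Fintype S] (x : EuclideanSpace ℝ S) (s : S) :
    |x s| ≤ ‖x‖ :=
  PiLp.norm_apply_le x s

lemma tdError_sub {S A : Type*} (M : MDP S A) (n : ℕ) (V W : EuclideanSpace ℝ S)
    (ω : ℕ → S × A) : tdError M n V ω =
      tdError M n W ω + M.γ ^ n * (V - W) (ω n).1 - (V - W) (ω 0).1 := by
  simp only [tdError, PiLp.sub_apply]
  ring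

lemma abs_tdError_le {S A : Type*} [Fintype S] {M : MDP S A} {n : ℕ} {V W : EuclideanSpace ℝ S}
    {ω : ℕ → S × A} {B : ℝ} (hB : |tdError M n W ω| ≤ B) :
    |tdError M n V ω| ≤ B + 2 * ‖V - W‖ := by
  rw [tdError_sub M n V W]
  have h1 := abs_apply_le_norm (V - W) (ω n).1
  have h2 := abs_apply_le_norm (V - W) (ω 0).1
  have hγ := M.γ_mem
  have h3 : |M.γ ^ n * (V - W) (ω n).1| ≤ ‖V - W‖ := by
    rw [abs_mul, abs_of_nonneg (pow_nonneg hγ.1.le n)]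
    exact (mul_le_of_le_one_left (abs_nonneg _) (pow_le_one₀ hγ.1.le hγ.2.le)).trans h1
  rw [abs_le] at *
  constructor <;> linarith

/-- The directional derivative of half the squared error along an update. -/
noncomputable def crossTerm {S : Type*} (D g : ℝ) (s s' : S) (x : EuclideanSpace ℝ S) : ℝ :=
  x s * (D + g * x s' - x s)

lemma crossTerm_sub_le {S : Type*} [Fintype S] {D g B : ℝ} (hg0 : 0 ≤ g) (hg1 : g ≤ 1)
    (hD : |D| ≤ B) (s s' : S) (x y : EuclideanSpace ℝ S) :
    crossTerm D g s s' x - crossTerm D g s s' y ≤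
      ‖x - y‖ * B + 2 * ‖x - y‖ * (‖x‖ + ‖y‖) := by
  have e : crossTerm D g s s' x - crossTerm D g s s' y = (x - y) s * D +
      (x - y) s * (g * x s' - x s) + y s * (g * (x - y) s' - (x - y) s) := by
    simp only [crossTerm, PiLp.sub_apply]
    ring
  have hlin : ∀ z : EuclideanSpace ℝ S, |g * z s' - z s| ≤ 2 * ‖z‖ := by
    intro z
    have h1 := abs_apply_le_norm z s'
    have h2 := abs_apply_le_norm z s
    have h3 : |g * z s'| ≤ ‖z‖ := by
      rw [abs_mul, abs_of_nonneg hg0]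
      exact (mul_le_of_le_one_left (abs_nonneg _) hg1).trans h1
    rw [abs_le] at *
    constructor <;> linarith
  have m1 : (x - y) s * D ≤ ‖x - y‖ * B :=
    (le_abs_self _).trans (by
      rw [abs_mul]
      exact mul_le_mul (abs_apply_le_norm _ s) hD (abs_nonneg _) (norm_nonneg _))
  have m2 : (x - y) s * (g * x s' - x s) ≤ ‖x - y‖ * (2 * ‖x‖) :=
    (le_abs_self _).trans (by
      rw [abs_mul]
      exact mul_le_mul (abs_apply_le_norm _ s) (hlin x) (abs_nonneg _) (norm_nonneg _))
  have m3 : y s * (g * (x - y) s' - (x - y) s) ≤ ‖y‖ * (2 * ‖x - y‖) :=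
    (le_abs_self _).trans (by
      rw [abs_mul]
      exact mul_le_mul (abs_apply_le_norm _ s) (hlin (x - y)) (abs_nonneg _) (norm_nonneg _))
  rw [e]
  linarith

lemma norm_add_single_sq (x : EuclideanSpace ℝ S) (s : S) (c : ℝ) :
    ‖x + EuclideanSpace.single s c‖ ^ 2 = ‖x‖ ^ 2 + 2 * (x s * c) + c ^ 2 := by
  rw [norm_add_sq_real, EuclideanSpace.inner_single_right]
  simp [mul_comm]

variable {M : MDP S A} {n : ℕ} {α B : ℝ} {V₀ W : EuclideanSpace ℝ S} {ω : ℕ → S × A}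

lemma norm_tdIterate_succ_sub_le (hα : 0 ≤ α)
    (hB : ∀ k, |tdError M n W fun i => ω (k + i)| ≤ B) (k : ℕ) :
    ‖(tdIterate M n (fun _ => α) V₀ ω (k + 1) - W) - (tdIterate M n (fun _ => α) V₀ ω k - W)‖ ≤
      α * (B + 2 * ‖tdIterate M n (fun _ => α) V₀ ω k - W‖) := by
  rw [sub_sub_sub_cancel_right, tdIterate_succ, add_sub_cancel_left, PiLp.norm_single,
    Real.norm_eq_abs, abs_mul, abs_of_nonneg hα]
  exact mul_le_mul_of_nonneg_left (abs_tdError_le (hB k)) hα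

/-- One-step drift of the squared error, up to the cross term evaluated at the iterate `m`. -/
lemma norm_sq_tdIterate_succ_le (hα : 0 ≤ α) (hB0 : 0 ≤ B)
    (hB : ∀ k, |tdError M n W fun i => ω (k + i)| ≤ B) {c : ℝ} (hc : c ≤ 1) {m T : ℕ}
    (hT : 1 ≤ T) (hαT : 1000 * (α * T) ≤ c) :
    ‖tdIterate M n (fun _ => α) V₀ ω (m + T + 1) - W‖ ^ 2 ≤
      (1 - α * c) * ‖tdIterate M n (fun _ => α) V₀ ω (m + T) - W‖ ^ 2 +
        98 * α * (α * T) * B ^ 2 +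
        2 * α * (crossTerm (tdError M n W fun i => ω (m + T + i)) (M.γ ^ n) (ω (m + T)).1
          (ω (m + T + n)).1 (tdIterate M n (fun _ => α) V₀ ω m - W) -
          (4 * α - c) * ‖tdIterate M n (fun _ => α) V₀ ω m - W‖ ^ 2) := by
  set x : ℕ → EuclideanSpace ℝ S := fun k => tdIterate M n (fun _ => α) V₀ ω k - W with hx
  have hγ := M.γ_mem
  have hstep : ∀ k, ‖x (k + 1) - x k‖ ≤ α * (B + 2 * ‖x k‖) :=
    norm_tdIterate_succ_sub_le hα hB
  set D := tdError M n W fun i => ω (m + T + i) with hD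
  set Γ := tdError M n (tdIterate M n (fun _ => α) V₀ ω (m + T)) fun i => ω (m + T + i) with hΓ
  have hΓe : Γ = D + M.γ ^ n * x (m + T) (ω (m + T + n)).1 - x (m + T) (ω (m + T)).1 :=
    tdError_sub M n _ W _
  have hΓb : |Γ| ≤ B + 2 * ‖x (m + T)‖ := abs_tdError_le (hB (m + T))
  have hsucc : ‖x (m + T + 1)‖ ^ 2 = ‖x (m + T)‖ ^ 2 +
      2 * α * crossTerm D (M.γ ^ n) (ω (m + T)).1 (ω (m + T + n)).1 (x (m + T)) +
      α ^ 2 * Γ ^ 2 := by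
    have : x (m + T + 1) = x (m + T) + EuclideanSpace.single (ω (m + T)).1 (α * Γ) := by
      simp only [hx, tdIterate_succ, ← hΓ]
      abel
    rw [this, norm_add_single_sq, crossTerm, ← hΓe]
    ring
  have hΓ2 : Γ ^ 2 ≤ (B + 2 * ‖x (m + T)‖) ^ 2 := by
    rw [← sq_abs]
    exact pow_le_pow_left₀ (abs_nonneg _) hΓb 2
  have hcross := crossTerm_sub_le (pow_nonneg hγ.1.le n) (pow_le_one₀ hγ.1.le hγ.2.le) (hB (m + T))
    (ω (m + T)).1 (ω (m + T + n)).1 (x (m + T)) (x m)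
  -- The term (4α - c)‖x m‖² is the bound for the conditional mean of the lagged cross term, so the
  -- bracket left in the conclusion will have nonpositive expectation.
  have hscal := drift_scalar_bound (norm_nonneg (x (m + T))) (norm_nonneg (x m)) hB0 hα
    (τ := T) (by exact_mod_cast hT) hc hαT (norm_nonneg (x (m + T) - x m))
    (norm_sub_le_of_step hα hB0 hstep m T (by linarith))
    (norm_le_norm_add_norm_sub' _ _) (norm_le_norm_add_norm_sub _ _)
  have k1 := mul_le_mul_of_nonneg_left hcross (by linarith : 0 ≤ 2 * α)
  have k2 := mul_le_mul_of_nonneg_left hΓ2 (sq_nonneg α)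
  change ‖x (m + T + 1)‖ ^ 2 ≤ (1 - α * c) * ‖x (m + T)‖ ^ 2 + 98 * α * (α * T) * B ^ 2 +
    2 * α * (crossTerm D (M.γ ^ n) (ω (m + T)).1 (ω (m + T + n)).1 (x m) -
      (4 * α - c) * ‖x m‖ ^ 2)
  rw [hsucc]
  linarith

lemma norm_sq_tdIterate_initial_le (hα : 0 ≤ α) (hB0 : 0 ≤ B)
    (hB : ∀ k, |tdError M n W fun i => ω (k + i)| ≤ B) {T : ℕ} (hαT : 1000 * (α * T) ≤ 1) :
    ‖tdIterate M n (fun _ => α) V₀ ω T - W‖ ^ 2 ≤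
      (‖V₀ - W‖ + ‖V₀‖ + 4) ^ 2 + 128 * (α * T * (4 * ‖W‖ + B) ^ 2) := by
  have h := norm_sub_le_of_step (x := fun k => tdIterate M n (fun _ => α) V₀ ω k - W) hα hB0
    (norm_tdIterate_succ_sub_le hα hB) 0 T
    (by have : 0 ≤ α * T := by positivity
        linarith)
  rw [zero_add] at h
  have h1 := initial_scalar_bound (norm_nonneg (V₀ - W)) (norm_nonneg V₀) (norm_nonneg W) hB0
    (by positivity) hαT (norm_sub_le V₀ W) (norm_nonneg _) h
  refine le_trans (pow_le_pow_left₀ (norm_nonneg _) ?_ 2) h1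
  exact norm_le_norm_add_norm_sub' _ _

end Pathwise

/-! ### Drift under a nearly stationary law -/

section StationaryDrift

variable {S A : Type*} [Fintype S] {M : MDP S A} {π : Policy S A} {κ : S → ℝ}

lemma sum_mul_drift_le_of_tvDist [Fintype A] [DecidableEq S]
    (hκ : IsStationary (transMatrix M π) κ) {p : S → ℝ} {α : ℝ}
    (hp : tvDist p κ ≤ α) (n : ℕ) (x : EuclideanSpace ℝ S) :
    ∑ s, p s * (x s * (M.γ ^ n * ((transMatrix M π ^ n) *ᵥ x) s - x s)) ≤
      (4 * α - kMin κ * (1 - M.γ ^ n)) * ‖x‖ ^ 2 := by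
  have hγ := M.γ_mem
  have hP := transMatrix_mem_rowStochastic M π
  have hg0 := pow_nonneg hγ.1.le n
  have hg1 : M.γ ^ n ≤ 1 := pow_le_one₀ hγ.1.le hγ.2.le
  have h1 := hκ.sum_mul_drift_le hP n hg0 hg1 x
  have hPx : ∀ s, |((transMatrix M π ^ n) *ᵥ x) s| ≤ ‖x‖ := by
    intro s
    rw [Matrix.mulVec, dotProduct]
    calc _ ≤ ∑ i, (transMatrix M π ^ n) s i * ‖x‖ := by
          refine (abs_sum_le_sum_abs _ _).trans (sum_le_sum fun i _ => ?_)
          rw [abs_mul, abs_of_nonneg (Matrix.nonneg_of_mem_rowStochastic (pow_mem hP n))]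
          exact mul_le_mul_of_nonneg_left (abs_apply_le_norm x i)
            (Matrix.nonneg_of_mem_rowStochastic (pow_mem hP n))
      _ = ‖x‖ := by
          rw [← sum_mul, Matrix.sum_row_of_mem_rowStochastic (pow_mem hP n), one_mul]
  have hψ : ∀ s, |x s * (M.γ ^ n * ((transMatrix M π ^ n) *ᵥ x) s - x s)| ≤ 2 * ‖x‖ ^ 2 := by
    intro s
    have h2 := abs_apply_le_norm x s
    have h3 : |M.γ ^ n * ((transMatrix M π ^ n) *ᵥ x) s - x s| ≤ 2 * ‖x‖ := by
      have h4 : |M.γ ^ n * ((transMatrix M π ^ n) *ᵥ x) s| ≤ ‖x‖ := by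
        rw [abs_mul, abs_of_nonneg hg0]
        exact (mul_le_of_le_one_left (abs_nonneg _) hg1).trans (hPx s)
      rw [abs_le] at *
      constructor <;> linarith
    rw [abs_mul]
    calc _ ≤ ‖x‖ * (2 * ‖x‖) := mul_le_mul h2 h3 (abs_nonneg _) (norm_nonneg _)
      _ = _ := by ring
  have h5 := (le_abs_self _).trans (abs_sum_mul_sub_le_tvDist p κ _ hψ)
  have h6 : 2 * tvDist p κ * (2 * ‖x‖ ^ 2) ≤ 2 * α * (2 * ‖x‖ ^ 2) := by gcongr
  have h7 : ∑ s, x s ^ 2 = ‖x‖ ^ 2 := (EuclideanSpace.real_norm_sq_eq x).symm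
  rw [h7] at h1
  linarith

lemma one_sub_beta3_eq_and_le_one [Nonempty S] [Fintype A]
    (hκ : IsStationary (transMatrix M π) κ) (n : ℕ) :
    1 - beta3 M κ n = kMin κ * (1 - M.γ ^ n) ∧ 1 - beta3 M κ n ≤ 1 := by
  have e : 1 - beta3 M κ n = kMin κ * (1 - M.γ ^ n) := by
    rw [beta3]
    ring
  refine ⟨e, ?_⟩
  rw [e]
  have hγ := M.γ_mem
  have hg0 := pow_nonneg hγ.1.le n
  have hg1 : M.γ ^ n ≤ 1 := pow_le_one₀ hγ.1.le hγ.2.le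
  obtain ⟨s⟩ := ‹Nonempty S›
  have h1 : kMin κ ≤ 1 := (ciInf_le (Set.finite_range κ).bddBelow s).trans
    (hκ.1.2 ▸ single_le_sum (fun i _ => hκ.1.1 i) (mem_univ s))
  exact mul_le_one₀ h1 (by linarith) (by linarith)

end StationaryDrift

/-! ### Expected drift and the finite-sample bound -/

section Drift

variable {S A : Type*} [MeasurableSpace S] [DiscreteMeasurableSpace S] [Fintype S]
  [MeasurableSpace A] [DiscreteMeasurableSpace A] [Fintype A] [DecidableEq S]
  {M : MDP S A} {π : Policy S A} {ν : PMF S} {κ : S → ℝ}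

/-- The expected cross term at a lagged iterate. -/
lemma integral_crossTerm_le (hκ : IsStationary (transMatrix M π) κ) {α : ℝ} {t : ℕ}
    (ht : ∀ s, tvDist ((transMatrix M π ^ t) s) κ ≤ α) {j n : ℕ}
    {X : (ℕ → S × A) → EuclideanSpace ℝ S} (hX : DependsOnUpToState j X) :
    ∫ ω, crossTerm (tdError M n (valueFn M π) fun i => ω (j + t + i)) (M.γ ^ n) (ω (j + t)).1
        (ω (j + t + n)).1 (X ω) ∂(trajLaw M π ν) ≤
      ∫ ω, (4 * α - kMin κ * (1 - M.γ ^ n)) * ‖X ω‖ ^ 2 ∂(trajLaw M π ν) := by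
  set g := M.γ ^ n with hg
  set k := j + t with hk
  have hXk : DependsOnUpToState k X := hX.mono (Nat.le_add_right j t)
  have hXj : DependsOn X (Set.Iic j) := hX.dependsOn
  have hXk' : DependsOn X (Set.Iic k) := hXk.dependsOn
  have hXkn : DependsOn X (Set.Iic (k + n)) := (hXk.mono (Nat.le_add_right k n)).dependsOn
  -- H is the linear part of the cross term as a function of S_{k+n}; averaging over those n steps
  -- gives K at S_k, whose randomness is otherwise fixed by time j.
  set H : (ℕ → S × A) → S → ℝ := fun ω s' => X ω (ω k).1 * (g * X ω s' - X ω (ω k).1) with hH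
  set K : (ℕ → S × A) → S → ℝ := fun ω s =>
    X ω s * (g * ((transMatrix M π ^ n) *ᵥ X ω) s - X ω s) with hK
  have hHd : DependsOnUpToState k H := by
    intro ω ω' h h'
    simp only [hH, hXk h h', h']
  have hKd : DependsOnUpToState j K := by
    intro ω ω' h h'
    simp only [hK, hX h h']
  have hG : DependsOnUpToState k fun ω => X ω (ω k).1 := by
    intro ω ω' h h'
    simp only [hXk h h', h']
  have i1 : Integrable (fun ω => X ω (ω k).1 *
      tdError M n (valueFn M π) fun i => ω (k + i)) (trajLaw M π ν) :=
    integrable_of_dependsOn (N := k + n) fun ω ω' h => by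
      have h2 := tdError_dependsOn M n k (valueFn M π) h
      simp only at h2
      rw [hXkn h, h2, h k (Nat.le_add_right k n)]
  have i2 : Integrable (fun ω => H ω (ω (k + n)).1) (trajLaw M π ν) :=
    integrable_of_dependsOn (N := k + n) fun ω ω' h => by
      simp only [hH, hXkn h, h k (Nat.le_add_right k n), h (k + n) Set.self_mem_Iic]
  calc _ = ∫ ω, (X ω (ω k).1 * (tdError M n (valueFn M π) fun i => ω (k + i)) +
        H ω (ω (k + n)).1) ∂(trajLaw M π ν) := by
        refine integral_congr_ae (Filter.Eventually.of_forall fun ω => ?_)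
        simp only [crossTerm, hH]
        ring
    _ = ∫ ω, H ω (ω (k + n)).1 ∂(trajLaw M π ν) := by
        rw [integral_add i1 i2, integral_mul_tdError_valueFn hG, zero_add]
    _ = ∫ ω, K ω (ω k).1 ∂(trajLaw M π ν) := by
        rw [integral_state_add hHd]
        refine integral_congr_ae (Filter.Eventually.of_forall fun ω => ?_)
        have hrow := Matrix.sum_row_of_mem_rowStochastic
          (pow_mem (transMatrix_mem_rowStochastic M π) n) (ω k).1
        simp only [hH, hK, Matrix.mulVec, dotProduct]
        rw [mul_sub, mul_sum, mul_sum]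
        have e : ∀ i, (transMatrix M π ^ n) (ω k).1 i *
            (X ω (ω k).1 * (g * X ω i - X ω (ω k).1)) =
            X ω (ω k).1 * (g * ((transMatrix M π ^ n) (ω k).1 i * X ω i)) -
            (transMatrix M π ^ n) (ω k).1 i * (X ω (ω k).1 * X ω (ω k).1) := fun i => by ring
        simp_rw [e]
        rw [sum_sub_distrib, ← sum_mul, hrow, one_mul]
    _ = ∫ ω, ((transMatrix M π ^ t) *ᵥ K ω) (ω j).1 ∂(trajLaw M π ν) :=
        integral_state_add hKd t
    _ ≤ _ := by
        refine integral_mono ?_ ?_ fun ω => ?_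
        · exact integrable_of_dependsOn (N := j) fun ω ω' h => by
            simp only [hKd.dependsOn h, h j Set.self_mem_Iic]
        · exact integrable_of_dependsOn (N := j) fun ω ω' h => by
            simp only [hXj h]
        · exact sum_mul_drift_le_of_tvDist hκ (ht _) n (X ω)

/-- The finite-sample bound under the law of the trajectory. -/
lemma integral_norm_sq_tdIterate_sub_le [Nonempty S] (hκ : IsStationary (transMatrix M π) κ)
    {α : ℝ} (hα : 0 < α) {t : ℕ} (ht : ∀ s, tvDist ((transMatrix M π ^ t) s) κ ≤ α) {n : ℕ}
    (hn : 1 ≤ n) (V₀ : EuclideanSpace ℝ S) {c : ℝ} (hc : c = 1 - beta3 M κ n)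
    (hαT : 1000 * (α * (t + n)) ≤ c) {k : ℕ} (hk : t + n ≤ k) :
    ∫ ω, ‖tdIterate M n (fun _ => α) V₀ ω k - valueFn M π‖ ^ 2 ∂(trajLaw M π ν) ≤
      (‖V₀ - valueFn M π‖ + ‖V₀‖ + 4) ^ 2 * (1 - c * α) ^ (k - (t + n)) +
        228 * (4 * (1 - M.γ) * ‖valueFn M π‖ + 1) ^ 2 *
          (α * (t + n) / ((1 - M.γ) ^ 2 * c)) := by
  obtain ⟨hce, hc1⟩ := one_sub_beta3_eq_and_le_one (M := M) hκ n
  rw [← hc] at hce hc1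
  set v := valueFn M π with hv
  set B := (1 - M.γ)⁻¹ with hB
  have hγ1 : 0 < 1 - M.γ := sub_pos.2 M.γ_mem.2
  have hB0 : 0 < B := inv_pos.2 hγ1
  set T := t + n with hT
  have hT1 : 1 ≤ T := by lia
  have hTc : (T : ℝ) = t + n := by rw [hT]; push_cast; rfl
  rw [← hTc] at hαT ⊢
  have hT0 : (1 : ℝ) ≤ T := by exact_mod_cast hT1
  have haT : 0 < α * T := by positivity
  have hc0 : 0 < c := by linarith
  have hαc : α * c < 1 := by
    have h1 : α ≤ α * T := le_mul_of_one_le_right hα.le hT0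
    have h2 : α * c ≤ α := mul_le_of_le_one_right hα.le hc1
    linarith
  have hDb : ∀ (ω : ℕ → S × A) (k : ℕ), |tdError M n v fun i => ω (k + i)| ≤ B := fun ω k =>
    abs_tdError_valueFn_le M π n _
  set V : ℕ → (ℕ → S × A) → EuclideanSpace ℝ S := fun k ω =>
    tdIterate M n (fun _ => α) V₀ ω k - v with hV
  have hVd : ∀ m, DependsOnUpToState (m + n) (V m) := fun m ω ω' h _ => by
    simp only [hV, tdIterate_congr M n _ V₀ m h]
  have hVi : ∀ m, Integrable (fun ω => ‖V m ω‖ ^ 2) (trajLaw M π ν) := fun m =>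
    integrable_of_dependsOn (N := m + n) fun ω ω' h => by
      simp only [(hVd m).dependsOn h]
  set E : ℕ → ℝ := fun k => ∫ ω, ‖V k ω‖ ^ 2 ∂(trajLaw M π ν) with hE
  have hrec : ∀ k, T ≤ k → E (k + 1) ≤ (1 - α * c) * E k + 98 * α * (α * T) * B ^ 2 := by
    intro k hk
    obtain ⟨m, rfl⟩ : ∃ m, k = m + T := ⟨k - T, by lia⟩
    set C : (ℕ → S × A) → ℝ := fun ω => crossTerm (tdError M n v fun i => ω (m + T + i))
      (M.γ ^ n) (ω (m + T)).1 (ω (m + T + n)).1 (V m ω) with hC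
    have hCi : Integrable C (trajLaw M π ν) :=
      integrable_of_dependsOn (N := m + T + n) fun ω ω' h => by
        have h2 := tdError_dependsOn M n (m + T) v h
        have h3 : V m ω = V m ω' := (hVd m).dependsOn fun i hi => h i (by
          rw [Set.mem_Iic] at *
          lia)
        simp only at h2
        simp only [hC, h2, h3, h (m + T) (Nat.le_add_right _ n), h (m + T + n) Set.self_mem_Iic]
    have hCle : ∫ ω, C ω ∂(trajLaw M π ν) ≤ ∫ ω, (4 * α - c) * ‖V m ω‖ ^ 2 ∂(trajLaw M π ν) := by
      have := integral_crossTerm_le (ν := ν) hκ ht (n := n) (hVd m)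
      -- Conditioning takes place at time m + n, when V_m is already known, and mixing takes the
      -- remaining t steps.
      rw [← hce, show m + n + t = m + T by lia] at this
      exact this
    have hbd : ∀ ω, ‖V (m + T + 1) ω‖ ^ 2 ≤ (1 - α * c) * ‖V (m + T) ω‖ ^ 2 +
        98 * α * (α * T) * B ^ 2 + 2 * α * (C ω - (4 * α - c) * ‖V m ω‖ ^ 2) := fun ω =>
      norm_sq_tdIterate_succ_le hα.le hB0.le (hDb ω) hc1 hT1 hαT
    have j1 := (hVi (m + T)).const_mul (1 - α * c)
    have j2 : Integrable (fun _ : ℕ → S × A => 98 * α * (α * T) * B ^ 2) (trajLaw M π ν) :=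
      integrable_const _
    have j3 := (hVi m).const_mul (4 * α - c)
    have j4 : Integrable (fun ω => 2 * α * (C ω - (4 * α - c) * ‖V m ω‖ ^ 2))
      (trajLaw M π ν) := (hCi.sub j3).const_mul (2 * α)
    have j5 : Integrable (fun ω => (1 - α * c) * ‖V (m + T) ω‖ ^ 2 +
      98 * α * (α * T) * B ^ 2) (trajLaw M π ν) := j1.add j2
    have hint := integral_mono (hVi (m + T + 1)) (j5.add j4) hbd
    simp only [Pi.add_apply] at hint
    rw [integral_add j5 j4, integral_add j1 j2, integral_const_mul, integral_const_mul (2 * α),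
      integral_sub hCi j3, integral_const, probReal_univ, one_smul] at hint
    have := mul_le_mul_of_nonneg_left hCle (by linarith : 0 ≤ 2 * α)
    simp only [hE]
    linarith
  have hinit : E T ≤ (‖V₀ - v‖ + ‖V₀‖ + 4) ^ 2 + 128 * (α * T * (4 * ‖v‖ + B) ^ 2) := by
    have := integral_mono (hVi T) (integrable_const _) fun ω =>
      norm_sq_tdIterate_initial_le (V₀ := V₀) hα.le hB0.le (hDb ω) (T := T) (by linarith)
    simpa using this
  -- The noise contributes 98 and the start at time T contributes 128; their sum 226 is below 228.
  have hfin := le_geometric_of_le_mul_add (E := E) (by linarith) (by linarith [mul_pos hα hc0])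
    (by positivity) hrec hk
  have hρ0 : 0 ≤ (1 - α * c) ^ (k - T) := pow_nonneg (by linarith) _
  have hρ1 : (1 - α * c) ^ (k - T) ≤ 1 :=
    pow_le_one₀ (by linarith) (by linarith [mul_pos hα hc0])
  set L := 4 * ‖v‖ + B with hL
  have hBL : B ≤ L := by have := norm_nonneg v; linarith
  have hQ : 228 * (4 * (1 - M.γ) * ‖v‖ + 1) ^ 2 * (α * T / ((1 - M.γ) ^ 2 * c)) =
      228 * (α * T * L ^ 2 / c) := by
    rw [hL, hB]
    field_simp
  have hnoise : 98 * α * (α * T) * B ^ 2 / (1 - (1 - α * c)) ≤ 98 * (α * T * L ^ 2 / c) := by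
    have e : 98 * α * (α * T) * B ^ 2 / (1 - (1 - α * c)) = 98 * (α * T * B ^ 2 / c) := by
      rw [sub_sub_cancel]
      field_simp
    rw [e]
    gcongr
  have hstart : 128 * (α * T * L ^ 2) ≤ 128 * (α * T * L ^ 2 / c) := by
    have : α * T * L ^ 2 ≤ α * T * L ^ 2 / c := le_div_self (by positivity) hc0 hc1
    linarith
  have h1 := mul_le_mul_of_nonneg_left hinit hρ0
  have h2 : (1 - α * c) ^ (k - T) * (128 * (α * T * L ^ 2)) ≤ 1 * (128 * (α * T * L ^ 2)) :=
    mul_le_mul_of_nonneg_right hρ1 (by positivity)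
  have h3 : 0 ≤ α * T * L ^ 2 / c := by positivity
  rw [hQ, mul_comm c α]
  change E k ≤ _
  linarith

end Drift

end NStepTD

/-! ### Transfer to a trajectory on an arbitrary probability space -/

theorem theorem3p3 :
    ∃ c₀ : ℝ, 0 < c₀ ∧
      ∀ (S A Ω : Type*) [Fintype S] [Nonempty S] [DecidableEq S] [MeasurableSpace S]
        [DiscreteMeasurableSpace S] [Fintype A] [MeasurableSpace A] [DiscreteMeasurableSpace A]
        [MeasurableSpace Ω] (μ : Measure Ω) [IsProbabilityMeasure μ]
        (M : NStepTD.MDP S A) (π : NStepTD.Policy S A),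
        (NStepTD.transMatrix M π).IsIrreducible →
        NStepTD.IsAperiodic (NStepTD.transMatrix M π) →
        ∀ κ : S → ℝ, NStepTD.IsStationary (NStepTD.transMatrix M π) κ →
        -- a sample trajectory under `π` with an arbitrary initial distribution
        ∀ (ν : PMF S) (St : ℕ → Ω → S) (Ac : ℕ → Ω → A),
          HasLaw (fun ω k => (St k ω, Ac k ω)) (NStepTD.trajLaw M π ν) μ →
        ∀ (n : ℕ), 1 ≤ n → ∀ (V₀ : EuclideanSpace ℝ S) (α : ℝ), 0 < α →
        ∀ (t : ℕ), t = NStepTD.mixingTime (NStepTD.transMatrix M π) κ α →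
        ∀ (β : ℝ), β = NStepTD.beta3 M κ n →
        ∀ (Vπ : EuclideanSpace ℝ S), Vπ = NStepTD.valueFn M π →
        ∀ (V : ℕ → Ω → EuclideanSpace ℝ S),
          V = (fun k ω => NStepTD.tdIterate M n (fun _ => α) V₀ (fun j => (St j ω, Ac j ω)) k) →
        α * (t + n) ≤ c₀ * (1 - β) →
        ∀ k : ℕ, t + n ≤ k →
          Integrable (fun ω => ‖V k ω - Vπ‖ ^ 2) μ ∧
          ∫ ω, ‖V k ω - Vπ‖ ^ 2 ∂μ ≤
            (‖V₀ - Vπ‖ + ‖V₀‖ + 4) ^ 2 * (1 - (1 - β) * α) ^ (k - (t + n))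
              + 228 * (4 * (1 - M.γ) * ‖Vπ‖ + 1) ^ 2 *
                (α * (t + n) / ((1 - M.γ) ^ 2 * (1 - β))) := by
  refine ⟨1 / 1000, by norm_num, ?_⟩
  intro S A Ω _ _ _ _ _ _ _ _ _ μ _ M π hirr hap κ hκ ν St Ac hlaw n hn V₀ α hα t ht β hβ Vπ hVπ
    V hV hcond k hk
  subst ht hβ hVπ hV
  have hP := NStepTD.transMatrix_mem_rowStochastic M π
  have hmix := NStepTD.tvDist_pow_mixingTime_le hP hirr hap hκ hα
  set t := NStepTD.mixingTime (NStepTD.transMatrix M π) κ α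
  set G : (ℕ → S × A) → ℝ := fun ω =>
    ‖NStepTD.tdIterate M n (fun _ => α) V₀ ω k - NStepTD.valueFn M π‖ ^ 2 with hG
  have hGd : DependsOn G (Set.Iic (k + n)) := by
    intro ω ω' h
    simp only [hG, NStepTD.tdIterate_congr M n _ V₀ k fun i hi => h i (Set.mem_Iic.2 hi.le)]
  have hGi : Integrable G (NStepTD.trajLaw M π ν) := NStepTD.integrable_of_dependsOn hGd
  constructor
  · have := hGi
    rw [← hlaw.map_eq] at this
    exact this.comp_aemeasurable hlaw.aemeasurable
  · have h1 := NStepTD.integral_norm_sq_tdIterate_sub_le (ν := ν) hκ hα hmix hn V₀ rfl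
      (by linarith) hk
    rw [← hlaw.integral_comp hGi.aestronglyMeasurable] at h1
    exact h1
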